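/- Let $A$ be a finite-dimensional algebra over a field, let $\mathscr{A}=A\text{-mod}$ be the category of finitely generated left $A$-modules, and let $\mathscr{C}$ be a full additive subcategory of $\mathscr{A}$ that is closed under direct summands and admissible, i.e. contravariantly finite (every $D\in\mathscr{A}$ has a right $\mathscr{C}$-approximation: a morphism $C\to D$ with $C\in\mathscr{C}$ through which every morphism $C'\to D$ with $C'\in\mathscr{C}$ factors) and such that every right $\mathscr{C}$-approximation is an epimorphism. A complex $X^\bullet$ in $\mathscr{A}$ is called $\mathscr{C}$-acyclic, or $\operatorname{Hom}_{\mathscr{A}}(\mathscr{C},-)$-exact, if $\operatorname{Hom}_{\mathscr{A}}(C,X^\bullet)$ is acyclic for all $C\in\mathscr{C}$, and $\operatorname{Hom}_{\mathscr{A}}(-,\mathscr{C})$-exact if $\operatorname{Hom}_{\mathscr{A}}(X^\bullet,C)$ is acyclic for all $C\in\mathscr{C}$. Let $\mathscr{G}(\mathscr{C})$ be the full subcategory of $\mathscr{A}$ of all $M$ isomorphic to $\operatorname{Im}(C^{-1}\to C^0)$ for some acyclic complex $C^\bullet$ with all terms in $\mathscr{C}$ that is both $\operatorname{Hom}_{\mathscr{A}}(\mathscr{C},-)$-exact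 and $\operatorname{Hom}_{\mathscr{A}}(-,\mathscr{C})$-exact. For $M\in\mathscr{A}$ let $\mathscr{C}\mathscr{G}(\mathscr{C})\text{-}\dim M\in\{0,1,2,\dots,\infty\}$ be the infimum of all $n\ge 0$ for which there is a $\operatorname{Hom}_{\mathscr{A}}(\mathscr{C},-)$-exact complex $0\to G^{-n}\to\cdots\to G^0\to M\to 0$ with all $G^i\in\mathscr{G}(\mathscr{C})$, and put $\mathscr{C}\mathscr{G}(\mathscr{C})\text{-}\dim\mathscr{A}=\sup_{M\in\mathscr{A}}\mathscr{C}\mathscr{G}(\mathscr{C})\text{-}\dim M$. Let $D^b_{\mathscr{C}}(\mathscr{A})=K^b(\mathscr{A})/K^b_{\mathscr{C}\text{-}ac}(\mathscr{A})$ be the Verdier quotient of the bounded homotopy category of $\mathscr{A}$ by its full subcategory of $\mathscr{C}$-acyclic complexes, and let $D_{\mathscr{C}\text{-}sg}(\mathscr{A})=D^b_{\mathscr{C}}(\mathscr{A})/K^b(\mathscr{C})$ be the $\mathscr{C}$-singularity category, the Verdier quotient by the bounded homotopy category of $\mathscr{C}$ viewed as a full subcategory of $D^b_{\mathscr{C}}(\mathscr{A})$.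 Let $\theta:\mathscr{G}(\mathscr{C})\to D_{\mathscr{C}\text{-}sg}(\mathscr{A})$ be the composition of the inclusion $\mathscr{G}(\mathscr{C})\hookrightarrow\mathscr{A}$, the functor $\mathscr{A}\to K^b(\mathscr{A})\to D^b_{\mathscr{C}}(\mathscr{A})$ that regards an object as a complex concentrated in degree $0$, and the quotient functor $D^b_{\mathscr{C}}(\mathscr{A})\to D_{\mathscr{C}\text{-}sg}(\mathscr{A})$. If $\mathscr{C}\mathscr{G}(\mathscr{C})\text{-}\dim\mathscr{A}<\infty$, then $\theta$ is essentially surjective: every object of $D_{\mathscr{C}\text{-}sg}(\mathscr{A})$ is isomorphic to $\theta(X')$ for some $X'\in\mathscr{G}(\mathscr{C})$. -/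

import Mathlib

open CategoryTheory CategoryTheory.Limits CategoryTheory.Pretriangulated Opposite

universe v u

noncomputable section

namespace RelSing

/-! ### Relative exactness, approximations, dimensions, the Gorenstein category -/

section Basic

variable {𝒜 : Type u} [Category.{v} 𝒜]

/-- A right `𝒞`-approximation of `D`: a morphism `f : C ⟶ D` with `C` in `𝒞` through which
every morphism to `D` from an object of `𝒞` factors. -/
def IsRightApprox (𝒞 : ObjectProperty 𝒜) {C D : 𝒜} (f : C ⟶ D) : Prop :=
  𝒞 C ∧ ∀ ⦃C' : 𝒜⦄, 𝒞 C' → ∀ g : C' ⟶ D, ∃ h : C' ⟶ C, h ≫ f = g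

/-- `𝒞` is contravariantly finite in `𝒜`. -/
def IsContravariantlyFinite (𝒞 : ObjectProperty 𝒜) : Prop :=
  ∀ D : 𝒜, ∃ (C : 𝒜) (f : C ⟶ D), IsRightApprox 𝒞 f

/-- `𝒞` is admissible: it is contravariantly finite and all right `𝒞`-approximations are epic. -/
def IsAdmissible (𝒞 : ObjectProperty 𝒜) : Prop :=
  IsContravariantlyFinite 𝒞 ∧ ∀ ⦃C D : 𝒜⦄ (f : C ⟶ D), IsRightApprox 𝒞 f → Epi f

variable [Abelian 𝒜]

/-- The complex `X` is `Hom(𝒞, -)`-exact (that is, `𝒞`-acyclic): the complex of abelian groups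
`Hom(C, X)` is acyclic for every `C` in `𝒞`. -/
def IsHomExact (𝒞 : ObjectProperty 𝒜) (X : CochainComplex 𝒜 ℤ) : Prop :=
  ∀ C : 𝒜, 𝒞 C →
    (((preadditiveCoyoneda.obj (op C)).mapHomologicalComplex (ComplexShape.up ℤ)).obj X).Acyclic

/-- The complex `X` is `Hom(-, 𝒞)`-exact: the complex of abelian groups
`Hom(X, C)` is acyclic for every `C` in `𝒞`. -/
def IsCohomExact (𝒞 : ObjectProperty 𝒜) (X : CochainComplex 𝒜 ℤ) : Prop :=
  ∀ C : 𝒜, 𝒞 C →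
    (((preadditiveYoneda.obj C).mapHomologicalComplex (ComplexShape.up ℤ).symm).obj X.op).Acyclic

/-- There is a `Hom(𝒞, -)`-exact complex `0 ⟶ D⁻ⁿ ⟶ ⋯ ⟶ D⁰ ⟶ M ⟶ 0` with all `Dⁱ` in `𝒟`.
The object `M` is put in degree `1`. -/
def HasProperResolution (𝒞 𝒟 : ObjectProperty 𝒜) (M : 𝒜) (n : ℕ) : Prop :=
  ∃ E : CochainComplex 𝒜 ℤ,
    (∀ i : ℤ, i < -(n : ℤ) → IsZero (E.X i)) ∧
    (∀ i : ℤ, -(n : ℤ) ≤ i → i ≤ 0 → 𝒟 (E.X i)) ∧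
    Nonempty (E.X 1 ≅ M) ∧
    (∀ i : ℤ, 1 < i → IsZero (E.X i)) ∧
    IsHomExact 𝒞 E

/-- The `𝒞`-proper `𝒟`-dimension of an object `M`. -/
def properDim (𝒞 𝒟 : ObjectProperty 𝒜) (M : 𝒜) : ℕ∞ :=
  ⨅ (n : ℕ) (_ : HasProperResolution 𝒞 𝒟 M n), (n : ℕ∞)

/-- The `𝒞`-proper `𝒟`-dimension of a class `ℰ` of objects. -/
def properDimOf (𝒞 𝒟 ℰ : ObjectProperty 𝒜) : ℕ∞ :=
  ⨆ (M : 𝒜) (_ : ℰ M), properDim 𝒞 𝒟 M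

end Basic

variable {𝒜 : Type u} [Category.{v} 𝒜] [Abelian 𝒜]

/-- The Gorenstein category `𝒢(𝒞)`: the objects isomorphic to `Im(C⁻¹ ⟶ C⁰)` for an acyclic
complex with terms in `𝒞` which is both `Hom(𝒞, -)`-exact and `Hom(-, 𝒞)`-exact. -/
def gorenstein (𝒞 : ObjectProperty 𝒜) : ObjectProperty 𝒜 := fun M =>
  ∃ X : CochainComplex 𝒜 ℤ, (∀ i : ℤ, 𝒞 (X.X i)) ∧ X.Acyclic ∧
    IsHomExact 𝒞 X ∧ IsCohomExact 𝒞 X ∧ Nonempty (M ≅ image (X.d (-1) 0))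

/-! ### The bounded homotopy category -/

/-- The bounded complexes, as a property of objects of the homotopy category. -/
def bounded (𝒜 : Type u) [Category.{v} 𝒜] [Abelian 𝒜] :
    ObjectProperty (HomotopyCategory 𝒜 (ComplexShape.up ℤ)) := fun X =>
  ∃ a b : ℤ, CochainComplex.IsStrictlyGE X.as a ∧ CochainComplex.IsStrictlyLE X.as b

lemma bounded_quotient_obj_iff (K : CochainComplex 𝒜 ℤ) :
    bounded 𝒜 ((HomotopyCategory.quotient 𝒜 (ComplexShape.up ℤ)).obj K) ↔
      ∃ a b : ℤ, K.IsStrictlyGE a ∧ K.IsStrictlyLE b := Iff.rfl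

lemma isStrictlyLE_mappingCone {K L : CochainComplex 𝒜 ℤ} (f : K ⟶ L)
    (n₁ n₂ n : ℤ) [K.IsStrictlyLE n₁] [L.IsStrictlyLE n₂] (hn₁ : n₁ ≤ n) (hn₂ : n₂ ≤ n) :
    (CochainComplex.mappingCone f).IsStrictlyLE n := by
  rw [CochainComplex.isStrictlyLE_iff]
  intro i hi
  simp only [CochainComplex.mappingCone.isZero_X_iff]
  exact ⟨K.isZero_of_isStrictlyLE n₁ _ (by lia), L.isZero_of_isStrictlyLE n₂ _ (by lia)⟩

open scoped ZeroObject in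
instance : (bounded 𝒜).ContainsZero where
  exists_zero :=
    ⟨(HomotopyCategory.quotient _ _).obj 0, Functor.map_isZero _ (isZero_zero _), by
      rw [bounded_quotient_obj_iff]
      exact ⟨0, 0, inferInstance, inferInstance⟩⟩

instance : (bounded 𝒜).IsStableUnderShift ℤ where
  isStableUnderShiftBy n :=
    { le_shift K hK := by
        obtain ⟨K : CochainComplex _ _, rfl⟩ := K.quotient_obj_surjective
        rw [bounded_quotient_obj_iff] at hK
        obtain ⟨a, b, _, _⟩ := hK
        rw [ObjectProperty.prop_shift_iff, HomotopyCategory.shift_quotient_obj,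
          bounded_quotient_obj_iff]
        exact ⟨a - n, b - n, K.isStrictlyGE_shift a n (a - n) (by lia),
          K.isStrictlyLE_shift b n (b - n) (by lia)⟩ }

instance : (bounded 𝒜).IsTriangulatedClosed₃ where
  ext₃' T hT h₁ h₂ := by
    obtain ⟨a₁, b₁, _, _⟩ := h₁
    obtain ⟨a₂, b₂, _, _⟩ := h₂
    obtain ⟨f : T.obj₁.as ⟶ T.obj₂.as, hf⟩ :=
      (HomotopyCategory.quotient _ _).map_surjective T.mor₁
    refine ⟨(HomotopyCategory.quotient _ _).obj (CochainComplex.mappingCone f), ?_,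
      ⟨Triangle.π₃.mapIso (isoTriangleOfIso₁₂ T _ hT
        (HomotopyCategory.mappingCone_triangleh_distinguished f)
        (Iso.refl _) (Iso.refl _) ?_)⟩⟩
    · rw [bounded_quotient_obj_iff]
      exact ⟨min (a₁ - 1) a₂, max b₁ b₂,
        CochainComplex.isStrictlyGE_mappingCone f a₁ a₂ _ (by simp) (by simp),
        isStrictlyLE_mappingCone f b₁ b₂ _ (by simp) (by simp)⟩
    · exact (Category.comp_id _).trans (hf.symm.trans (Category.id_comp _).symm)

instance : (bounded 𝒜).IsTriangulated where
  toIsTriangulatedClosed₂ := .of_isTriangulatedClosed₃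

/-- The bounded homotopy category `Kᵇ(𝒜)`. -/
abbrev Kb (𝒜 : Type u) [Category.{v} 𝒜] [Abelian 𝒜] := (bounded 𝒜).FullSubcategory

/-- The functor `𝒜 ⥤ Kᵇ(𝒜)` which sends an object to the complex concentrated in degree `0`. -/
def singleKb (𝒜 : Type u) [Category.{v} 𝒜] [Abelian 𝒜] : 𝒜 ⥤ Kb 𝒜 :=
  (bounded 𝒜).lift (CochainComplex.singleFunctor 𝒜 0 ⋙ HomotopyCategory.quotient 𝒜 _)
    (fun M => (bounded_quotient_obj_iff _).2
      ⟨0, 0, inferInstanceAs (((CochainComplex.singleFunctor 𝒜 0).obj M).IsStrictlyGE 0),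
        inferInstanceAs (((CochainComplex.singleFunctor 𝒜 0).obj M).IsStrictlyLE 0)⟩)

/-! ### The bounded relative derived category -/

/-- The `𝒞`-acyclic complexes, as a property of objects of the homotopy category. -/
def acyclicK (𝒞 : ObjectProperty 𝒜) :
    ObjectProperty (HomotopyCategory 𝒜 (ComplexShape.up ℤ)) := fun X => IsHomExact 𝒞 X.as

lemma acyclicK_iff (𝒞 : ObjectProperty 𝒜) (X : HomotopyCategory 𝒜 (ComplexShape.up ℤ)) :
    acyclicK 𝒞 X ↔ ∀ C : 𝒜, 𝒞 C →
      (HomotopyCategory.subcategoryAcyclic AddCommGrpCat.{v}).inverseImage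
        ((preadditiveCoyoneda.obj (op C)).mapHomotopyCategory (ComplexShape.up ℤ)) X :=
  forall₂_congr fun _ _ =>
    (HomotopyCategory.quotient_obj_mem_subcategoryAcyclic_iff_acyclic _).symm

instance (𝒞 : ObjectProperty 𝒜) : (acyclicK 𝒞).IsClosedUnderIsomorphisms where
  of_iso e h := by
    rw [acyclicK_iff] at h ⊢
    exact fun C hC => ObjectProperty.prop_of_iso _ e (h C hC)

open scoped ZeroObject in
instance (𝒞 : ObjectProperty 𝒜) : (acyclicK 𝒞).ContainsZero where
  exists_zero := ⟨0, isZero_zero _, by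
    rw [acyclicK_iff]
    exact fun C _ => ObjectProperty.prop_of_isZero _ (isZero_zero _)⟩

instance (𝒞 : ObjectProperty 𝒜) : (acyclicK 𝒞).IsStableUnderShift ℤ where
  isStableUnderShiftBy n :=
    { le_shift X hX := by
        rw [acyclicK_iff] at hX
        rw [ObjectProperty.prop_shift_iff, acyclicK_iff]
        exact fun C hC => ObjectProperty.le_shift _ n _ (hX C hC) }

instance (𝒞 : ObjectProperty 𝒜) : (acyclicK 𝒞).IsTriangulated where
  toIsTriangulatedClosed₂ := .mk' (fun T hT h₁ h₃ => by
    rw [acyclicK_iff] at h₁ h₃ ⊢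
    exact fun C hC => ObjectProperty.ext_of_isTriangulatedClosed₂ _ T hT (h₁ C hC) (h₃ C hC))

/-- The bounded `𝒞`-acyclic complexes `Kᵇ_{𝒞-ac}(𝒜)`, as a triangulated subcategory of
`Kᵇ(𝒜)`. -/
abbrev acyclicKb (𝒞 : ObjectProperty 𝒜) : ObjectProperty (Kb 𝒜) :=
  (acyclicK 𝒞).inverseImage (bounded 𝒜).ι

/-- The bounded `𝒞`-derived category, the Verdier quotient `Kᵇ(𝒜) / Kᵇ_{𝒞-ac}(𝒜)`. -/
abbrev Db (𝒞 : ObjectProperty 𝒜) := (acyclicKb 𝒞).trW.Localization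

/-- The quotient functor `Kᵇ(𝒜) ⥤ Dᵇ_𝒞(𝒜)`. -/
abbrev Qb (𝒞 : ObjectProperty 𝒜) : Kb 𝒜 ⥤ Db 𝒞 := (acyclicKb 𝒞).trW.Q

/-! ### The relative singularity category -/

/-- The bounded complexes with all terms in `𝒞`, as objects of `Kᵇ(𝒜)`. -/
def termsIn (𝒞 : ObjectProperty 𝒜) : ObjectProperty (Kb 𝒜) := fun X =>
  ∀ i : ℤ, 𝒞 (X.obj.as.X i)

/-- `Kᵇ(𝒞)` viewed as a full subcategory of `Dᵇ_𝒞(𝒜)`: the objects isomorphic to the image of a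
bounded complex with terms in `𝒞`. -/
def kbIn (𝒞 : ObjectProperty 𝒜) : ObjectProperty (Db 𝒞) := (termsIn 𝒞).map (Qb 𝒞)

/-- The `𝒞`-singularity category, the Verdier quotient `Dᵇ_𝒞(𝒜) / Kᵇ(𝒞)`: the morphisms whose
cone lies in `Kᵇ(𝒞)` are inverted. -/
abbrev Dsg (𝒞 : ObjectProperty 𝒜) := (kbIn 𝒞).trW.Localization

/-- The quotient functor `Dᵇ_𝒞(𝒜) ⥤ D_{𝒞-sg}(𝒜)`. -/
abbrev Qsg (𝒞 : ObjectProperty 𝒜) : Db 𝒞 ⥤ Dsg 𝒞 := (kbIn 𝒞).trW.Q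

/-- The natural functor `θ : 𝒢(𝒞) ⥤ D_{𝒞-sg}(𝒜)`, the composition
`𝒢(𝒞) ⥤ 𝒜 ⥤ Kᵇ(𝒜) ⥤ Dᵇ_𝒞(𝒜) ⥤ D_{𝒞-sg}(𝒜)`. -/
def theta (𝒞 : ObjectProperty 𝒜) : (gorenstein 𝒞).FullSubcategory ⥤ Dsg 𝒞 :=
  (gorenstein 𝒞).ι ⋙ singleKb 𝒜 ⋙ Qb 𝒞 ⋙ Qsg 𝒞

end RelSing

end

/-!
A bounded complex becomes isomorphic in `D_{𝒞-sg}(𝒜)` to an object of `𝒢(𝒞)` in degree `0` in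
three steps, each of which only uses cones of two kinds, namely `𝒞`-acyclic ones and bounded ones
with terms in `𝒞`.

* If `X` ends in degree `b + 1`, take a right `𝒞`-approximation `C ⟶ X.X (b + 1)`. The cone of
  `C[-b-1] ⟶ X` has a last differential which is surjective on `Hom(C', -)` for `C'` in `𝒞`, so
  it may be truncated in degrees `≤ b`. Iterating, `X` becomes an object `M` placed in some degree.
* `M` is replaced by a finite proper resolution by Gorenstein objects.
* If a complex of Gorenstein objects starts in degree `a + 1`, the object `G` in that degree has a
  map `j : G ⟶ C` to an object of `𝒞` such that, for every `f : G ⟶ G'` with `G'` in `𝒢(𝒞)`,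
  `(f, j) : G ⟶ G' ⊞ C` is a monomorphism with Gorenstein cokernel: the cokernel consists of the
  cycles of the cone of a morphism of complete resolutions which extends `-f`. Hence the cone of
  the map to `C` induced by `j` may be truncated at the bottom, which shortens the complex.
-/

noncomputable section

namespace RelSing

open CochainComplex

variable {𝒜 : Type u} [Category.{v} 𝒜] [Abelian 𝒜]

section

variable {𝒜 : Type u} [Category.{v} 𝒜]

/-- A `𝒞`-epimorphism: a morphism which becomes surjective after applying `Hom(C, -)` for every
`C` in `𝒞`. The right `𝒞`-approximations are the `𝒞`-epimorphisms with source in `𝒞`. -/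
def IsHomEpi (𝒞 : ObjectProperty 𝒜) {K L : 𝒜} (f : K ⟶ L) : Prop :=
  ∀ ⦃C : 𝒜⦄, 𝒞 C → ∀ y : C ⟶ L, ∃ t : C ⟶ K, t ≫ f = y

variable {𝒞 : ObjectProperty 𝒜} {K L M : 𝒜}

lemma IsHomEpi.comp {f : K ⟶ L} {g : L ⟶ M} (hf : IsHomEpi 𝒞 f) (hg : IsHomEpi 𝒞 g) :
    IsHomEpi 𝒞 (f ≫ g) := by
  intro C hC y
  obtain ⟨s, rfl⟩ := hg hC y
  obtain ⟨t, rfl⟩ := hf hC s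
  exact ⟨t, (Category.assoc _ _ _).symm⟩

lemma IsHomEpi.of_comp {f : K ⟶ L} {g : L ⟶ M} (h : IsHomEpi 𝒞 (f ≫ g)) : IsHomEpi 𝒞 g := by
  intro C hC y
  obtain ⟨t, rfl⟩ := h hC y
  exact ⟨t ≫ f, Category.assoc _ _ _⟩

lemma IsHomEpi.of_isIso (f : K ⟶ L) [IsIso f] : IsHomEpi 𝒞 f :=
  fun _ _ y => ⟨y ≫ inv f, by simp⟩

end

lemma isHomExact_iff (𝒞 : ObjectProperty 𝒜) (X : CochainComplex 𝒜 ℤ) :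
    IsHomExact 𝒞 X ↔ ∀ ⦃C : 𝒜⦄, 𝒞 C → ∀ (i j k : ℤ), i + 1 = j → j + 1 = k →
      ∀ φ : C ⟶ X.X j, φ ≫ X.d j k = 0 → ∃ ψ : C ⟶ X.X i, ψ ≫ X.d i j = φ := by
  refine forall₂_congr fun C _ => ⟨fun h i j k hij hjk φ hφ => ?_, fun h j => ?_⟩
  · have := h j
    rw [HomologicalComplex.exactAt_iff' _ i j k (by simp [← hij]) (by simp [hjk]),
      ShortComplex.ab_exact_iff] at this
    exact this φ hφ
  · rw [HomologicalComplex.exactAt_iff' _ (j - 1) j (j + 1) (by simp) (by simp),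
      ShortComplex.ab_exact_iff]
    exact fun φ hφ => h (j - 1) j (j + 1) (by simp) rfl φ hφ

lemma isCohomExact_iff (𝒞 : ObjectProperty 𝒜) (X : CochainComplex 𝒜 ℤ) :
    IsCohomExact 𝒞 X ↔ ∀ ⦃C : 𝒜⦄, 𝒞 C → ∀ (i j k : ℤ), i + 1 = j → j + 1 = k →
      ∀ φ : X.X j ⟶ C, X.d i j ≫ φ = 0 → ∃ ψ : X.X k ⟶ C, X.d j k ≫ ψ = φ := by
  refine forall₂_congr fun C _ => ⟨fun h i j k hij hjk φ hφ => ?_, fun h j => ?_⟩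
  · have := h j
    rw [HomologicalComplex.exactAt_iff' _ k j i (ComplexShape.prev_eq' _ hjk)
      (ComplexShape.next_eq' _ hij),
      ShortComplex.ab_exact_iff] at this
    exact this φ hφ
  · rw [HomologicalComplex.exactAt_iff' _ (j + 1) j (j - 1)
      (ComplexShape.prev_eq' _ (show j + 1 = j + 1 from rfl))
      (ComplexShape.next_eq' _ (show j - 1 + 1 = j by simp)),
      ShortComplex.ab_exact_iff]
    exact fun φ hφ => h (j - 1) j (j + 1) (by simp) rfl φ hφ

lemma IsHomExact.isHomEpi_toCycles {𝒞 : ObjectProperty 𝒜} {X : CochainComplex 𝒜 ℤ}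
    (hX : IsHomExact 𝒞 X) (i j : ℤ) (hij : i + 1 = j) : IsHomEpi 𝒞 (X.toCycles i j) := by
  intro C hC y
  obtain ⟨t, ht⟩ := (isHomExact_iff 𝒞 X).1 hX hC i j (j + 1) hij rfl (y ≫ X.iCycles j) (by simp)
  exact ⟨t, by simp [← cancel_mono (X.iCycles j), ht]⟩

lemma IsHomExact.shift {𝒞 : ObjectProperty 𝒜} {X : CochainComplex 𝒜 ℤ} (hX : IsHomExact 𝒞 X)
    (n : ℤ) : IsHomExact 𝒞 (X⟦n⟧) := by
  have h : acyclicK 𝒞 (((HomotopyCategory.quotient 𝒜 (ComplexShape.up ℤ)).obj X)⟦n⟧) :=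
    (acyclicK 𝒞).le_shift n _ hX
  rwa [HomotopyCategory.shift_quotient_obj] at h

section MappingCone

variable {𝒞 : ObjectProperty 𝒜} {K L : CochainComplex 𝒜 ℤ} {f : K ⟶ L}

lemma isHomExact_mappingCone
    (h : ∀ ⦃C : 𝒜⦄, 𝒞 C → ∀ (i j k : ℤ), i + 1 = j → j + 1 = k →
      ∀ (x : C ⟶ K.X k) (y : C ⟶ L.X j), x ≫ K.d k (k + 1) = 0 → y ≫ L.d j k = x ≫ f.f k →
        ∃ (t : C ⟶ K.X j) (z : C ⟶ L.X i), t ≫ K.d j k = x ∧ t ≫ f.f j + z ≫ L.d i j = y) :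
    IsHomExact 𝒞 (mappingCone f) := by
  rw [isHomExact_iff]
  intro C hC i j k hij hjk φ hφ
  obtain ⟨x, y, rfl⟩ := mappingCone.decomp_to f φ k hjk
  have hx : x ≫ K.d k (k + 1) = 0 := by
    simpa [mappingCone.d_fst_v f j k _ hjk rfl] using hφ =≫ (mappingCone.fst f).1.v k (k + 1) rfl
  have hxy : x ≫ f.f k + y ≫ L.d j k = 0 := by
    simpa [mappingCone.d_snd_v f j k hjk] using hφ =≫ (mappingCone.snd f).v k k (add_zero k)
  obtain ⟨t, z, hx', rfl⟩ := h hC i j k hij hjk (-x) y (by simp [hx])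
    (by simpa using eq_neg_of_add_eq_zero_right hxy)
  obtain rfl : x = -t ≫ K.d j k := by simp [hx']
  refine ⟨t ≫ (mappingCone.inl f).v j i (by lia) + z ≫ (mappingCone.inr f).f i, ?_⟩
  simp only [Preadditive.add_comp, Category.assoc, mappingCone.inl_v_d f j i k (by lia) (by lia),
    mappingCone.inr_f_d, Preadditive.comp_sub, Preadditive.neg_comp]
  abel

lemma isHomExact_mappingCone_of_mono [∀ i, Mono (f.f i)]
    (h : ∀ ⦃C : 𝒜⦄, 𝒞 C → ∀ (i j k : ℤ), i + 1 = j → j + 1 = k →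
      ∀ (x : C ⟶ K.X k) (y : C ⟶ L.X j), y ≫ L.d j k = x ≫ f.f k →
        ∃ (t : C ⟶ K.X j) (z : C ⟶ L.X i), t ≫ f.f j + z ≫ L.d i j = y) :
    IsHomExact 𝒞 (mappingCone f) :=
  isHomExact_mappingCone fun C hC i j k hij hjk x y _ hxy => by
    obtain ⟨t, z, rfl⟩ := h hC i j k hij hjk x y hxy
    exact ⟨t, z, by simpa [← cancel_mono (f.f k)] using hxy, rfl⟩

lemma isHomExact_mappingCone_of_isHomEpi (hf : ∀ i, IsHomEpi 𝒞 (f.f i))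
    (h : ∀ ⦃C : 𝒜⦄, 𝒞 C → ∀ (j k : ℤ), j + 1 = k →
      ∀ x : C ⟶ K.X k, x ≫ K.d k (k + 1) = 0 → x ≫ f.f k = 0 →
        ∃ t : C ⟶ K.X j, t ≫ K.d j k = x ∧ t ≫ f.f j = 0) :
    IsHomExact 𝒞 (mappingCone f) :=
  isHomExact_mappingCone fun C hC i j k _ hjk x y hx hxy => by
    obtain ⟨s, rfl⟩ := hf j hC y
    obtain ⟨t, ht, ht'⟩ := h hC j k hjk (x - s ≫ K.d j k) (by simp [hx])
      (by rw [Preadditive.sub_comp, ← hxy]; simp)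
    exact ⟨s + t, 0, by simp [ht], by simp [ht']⟩

end MappingCone

/-- A bounded cochain complex. -/
def IsBoundedComplex (K : CochainComplex 𝒜 ℤ) : Prop :=
  ∃ a b : ℤ, K.IsStrictlyGE a ∧ K.IsStrictlyLE b

lemma IsBoundedComplex.mk (K : CochainComplex 𝒜 ℤ) (a b : ℤ) [K.IsStrictlyGE a]
    [K.IsStrictlyLE b] : IsBoundedComplex K := ⟨a, b, inferInstance, inferInstance⟩

lemma IsBoundedComplex.mappingCone {K L : CochainComplex 𝒜 ℤ} (hK : IsBoundedComplex K)
    (hL : IsBoundedComplex L) (f : K ⟶ L) : IsBoundedComplex (mappingCone f) := by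
  obtain ⟨a₁, b₁, _, _⟩ := hK
  obtain ⟨a₂, b₂, _, _⟩ := hL
  exact ⟨min (a₁ - 1) a₂, max b₁ b₂,
    isStrictlyGE_mappingCone f a₁ a₂ _ (by simp) (by simp),
    isStrictlyLE_mappingCone f b₁ b₂ _ (by simp) (by simp)⟩

lemma IsBoundedComplex.shift {K : CochainComplex 𝒜 ℤ} (hK : IsBoundedComplex K) (n : ℤ) :
    IsBoundedComplex (K⟦n⟧) := by
  obtain ⟨a, b, _, _⟩ := hK
  exact ⟨a - n, b - n, K.isStrictlyGE_shift a n (a - n) (by lia),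
    K.isStrictlyLE_shift b n (b - n) (by lia)⟩

/-- The object of `Kᵇ(𝒜)` given by a bounded complex. -/
def toKb (K : CochainComplex 𝒜 ℤ) (hK : IsBoundedComplex K) : Kb 𝒜 :=
  ⟨(HomotopyCategory.quotient 𝒜 (ComplexShape.up ℤ)).obj K, hK⟩

/-- The relation of being isomorphic in `D_{𝒞-sg}(𝒜)` between cochain complexes, which includes that
both complexes are bounded. -/
def SgIso (𝒞 : ObjectProperty 𝒜) (K L : CochainComplex 𝒜 ℤ) : Prop :=
  ∃ (hK : IsBoundedComplex K) (hL : IsBoundedComplex L),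
    Nonempty ((Qsg 𝒞).obj ((Qb 𝒞).obj (toKb K hK)) ≅ (Qsg 𝒞).obj ((Qb 𝒞).obj (toKb L hL)))

namespace SgIso

variable {𝒞 : ObjectProperty 𝒜} {K L M : CochainComplex 𝒜 ℤ}

lemma symm (h : SgIso 𝒞 K L) : SgIso 𝒞 L K := by
  obtain ⟨hK, hL, ⟨e⟩⟩ := h
  exact ⟨hL, hK, ⟨e.symm⟩⟩

lemma trans (h : SgIso 𝒞 K L) (h' : SgIso 𝒞 L M) : SgIso 𝒞 K M := by
  obtain ⟨hK, hL, ⟨e⟩⟩ := h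
  obtain ⟨_, hM, ⟨e'⟩⟩ := h'
  exact ⟨hK, hM, ⟨e ≪≫ e'⟩⟩

lemma of_iso (hK : IsBoundedComplex K) (e : K ≅ L) : SgIso 𝒞 K L := by
  have hL : IsBoundedComplex L := by
    obtain ⟨a, b, _, _⟩ := hK
    exact ⟨a, b, isStrictlyGE_of_iso e a, isStrictlyLE_of_iso e b⟩
  exact ⟨hK, hL, ⟨(Qsg 𝒞).mapIso ((Qb 𝒞).mapIso ((bounded 𝒜).isoMk
    ((HomotopyCategory.quotient 𝒜 (ComplexShape.up ℤ)).mapIso e)))⟩⟩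

end SgIso

section Triangles

variable {𝒞 : ObjectProperty 𝒜}

lemma trW_homMk {P : ObjectProperty (Kb 𝒜)} [P.IsClosedUnderIsomorphisms]
    {T : Triangle (HomotopyCategory 𝒜 (ComplexShape.up ℤ))} (hT : T ∈ distTriang _)
    (h₁ : bounded 𝒜 T.obj₁) (h₂ : bounded 𝒜 T.obj₂) (h₃ : bounded 𝒜 T.obj₃)
    (h : P ⟨T.obj₃, h₃⟩) :
    P.trW (ObjectProperty.homMk T.mor₁ : (⟨T.obj₁, h₁⟩ : Kb 𝒜) ⟶ ⟨T.obj₂, h₂⟩) := by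
  obtain ⟨Z, g, w, hT'⟩ := distinguished_cocone_triangle
    (ObjectProperty.homMk T.mor₁ : (⟨T.obj₁, h₁⟩ : Kb 𝒜) ⟶ ⟨T.obj₂, h₂⟩)
  let e := isoTriangleOfIso₁₂ T _ hT ((bounded 𝒜).ι.map_distinguished _ hT')
    (Iso.refl _) (Iso.refl _) ((Category.comp_id _).trans (Category.id_comp _).symm)
  exact .mk _ hT' (P.prop_of_iso ((bounded 𝒜).isoMk (Triangle.π₃.mapIso e)) h)

lemma mapTriangle_rotate_distinguished {T : Triangle (CochainComplex 𝒜 ℤ)}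
    (hT : (HomotopyCategory.quotient 𝒜 _).mapTriangle.obj T ∈ distTriang _) :
    (HomotopyCategory.quotient 𝒜 _).mapTriangle.obj T.rotate ∈ distTriang _ :=
  isomorphic_distinguished _ (rot_of_distTriang _ hT) _
    ((HomotopyCategory.quotient 𝒜 _).mapTriangleRotateIso.app T).symm

instance : (kbIn 𝒞).IsClosedUnderIsomorphisms :=
  inferInstanceAs ((termsIn 𝒞).map (Qb 𝒞)).IsClosedUnderIsomorphisms

namespace SgIso

lemma of_distTriang_of_isHomExact {T : Triangle (CochainComplex 𝒜 ℤ)}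
    (hT : (HomotopyCategory.quotient 𝒜 _).mapTriangle.obj T ∈ distTriang _)
    (h₁ : IsBoundedComplex T.obj₁) (h₂ : IsBoundedComplex T.obj₂)
    (h₃ : IsBoundedComplex T.obj₃) (h : IsHomExact 𝒞 T.obj₃) :
    SgIso 𝒞 T.obj₁ T.obj₂ := by
  have := (acyclicKb 𝒞).trW.Q_inverts _ (trW_homMk hT h₁ h₂ h₃ h)
  exact ⟨h₁, h₂, ⟨(Qsg 𝒞).mapIso (@asIso _ _ _ _ _ this)⟩⟩

lemma of_distTriang_of_terms {T : Triangle (CochainComplex 𝒜 ℤ)}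
    (hT : (HomotopyCategory.quotient 𝒜 _).mapTriangle.obj T ∈ distTriang _)
    (h₁ : IsBoundedComplex T.obj₁) (h₂ : IsBoundedComplex T.obj₂)
    (h₃ : IsBoundedComplex T.obj₃) (h : ∀ i, 𝒞 (T.obj₃.X i)) :
    SgIso 𝒞 T.obj₁ T.obj₂ := by
  obtain ⟨Z, g, w, hT', hZ⟩ := trW_homMk (P := (kbIn 𝒞).inverseImage (Qb 𝒞)) hT h₁ h₂ h₃
    (ObjectProperty.prop_map_obj (termsIn 𝒞) (Qb 𝒞) h)
  have := (kbIn 𝒞).trW.Q_inverts _ (.mk _ ((Qb 𝒞).map_distinguished _ hT') hZ)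
  exact ⟨h₁, h₂, ⟨@asIso _ _ _ _ _ this⟩⟩

variable {K L : CochainComplex 𝒜 ℤ}

lemma of_isHomExact_mappingCone (hK : IsBoundedComplex K) (hL : IsBoundedComplex L) (f : K ⟶ L)
    (h : IsHomExact 𝒞 (mappingCone f)) : SgIso 𝒞 K L :=
  .of_distTriang_of_isHomExact (T := mappingCone.triangle f)
    (HomotopyCategory.mappingCone_triangleh_distinguished f) hK hL (hK.mappingCone hL f) h

lemma mappingCone_of_source_terms (hK : IsBoundedComplex K) (hL : IsBoundedComplex L)
    (f : K ⟶ L) (h : ∀ i, 𝒞 (K.X i)) : SgIso 𝒞 L (mappingCone f) :=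
  .of_distTriang_of_terms
    (mapTriangle_rotate_distinguished (HomotopyCategory.mappingCone_triangleh_distinguished f))
    hL (hK.mappingCone hL f) (hK.shift 1) fun i => h (i + 1)

lemma mappingCone_of_target_terms (hK : IsBoundedComplex K) (hL : IsBoundedComplex L)
    (f : K ⟶ L) (h : ∀ i, 𝒞 (L.X i)) : SgIso 𝒞 (mappingCone f) (K⟦(1 : ℤ)⟧) :=
  .of_distTriang_of_terms
    (mapTriangle_rotate_distinguished (mapTriangle_rotate_distinguished
      (HomotopyCategory.mappingCone_triangleh_distinguished f)))
    (hK.mappingCone hL f) (hK.shift 1) (hL.shift 1) fun i => h (i + 1)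

end SgIso

end Triangles

lemma isIso_πTruncGE_f (K : CochainComplex 𝒜 ℤ) (n i : ℤ) (hi : n < i) :
    IsIso ((K.πTruncGE n).f i) := by
  obtain ⟨j, hj⟩ := Int.le.dest hi.le
  have := K.isIso_restrictionToTruncGE' (ComplexShape.embeddingUpIntGE n) j (by
    rw [ComplexShape.boundaryGE_embeddingUpIntGE_iff]; lia)
  dsimp only [CochainComplex.πTruncGE, HomologicalComplex.πTruncGE]
  rw [ComplexShape.Embedding.liftExtend_f _ _ _ (i := j) hj]
  exact IsIso.comp_isIso' inferInstance (IsIso.comp_isIso' this (Iso.isIso_inv _))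

lemma πTruncGE_f_self (K : CochainComplex 𝒜 ℤ) (n : ℤ) :
    (K.πTruncGE n).f n = K.pOpcycles n ≫ (K.truncGEXIsoOpcycles n).inv := by
  have hj : (ComplexShape.embeddingUpIntGE n).f 0 = n := by simp
  dsimp only [CochainComplex.πTruncGE, HomologicalComplex.πTruncGE,
    CochainComplex.truncGEXIsoOpcycles, HomologicalComplex.truncGEXIsoOpcycles]
  rw [ComplexShape.Embedding.liftExtend_f _ _ _ (i := 0) hj,
    K.restrictionToTruncGE'_f_eq_iso_hom_pOpcycles_iso_inv _ hj
      (by rw [ComplexShape.boundaryGE_embeddingUpIntGE_iff])]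
  simp
  rfl

lemma isIso_ιTruncLE_f (K : CochainComplex 𝒜 ℤ) (n i : ℤ) (hi : i < n) :
    IsIso ((K.ιTruncLE n).f i) := by
  obtain ⟨j, hj⟩ := Int.le.dest hi.le
  have hj' : (ComplexShape.embeddingUpIntLE n).f j = i := by
    change n - (j : ℤ) = i; lia
  have := K.op.isIso_restrictionToTruncGE' (ComplexShape.embeddingUpIntLE n).op j (by
    rw [ComplexShape.Embedding.op_boundaryGE_iff,
      ComplexShape.boundaryLE_embeddingUpIntLE_iff]; lia)
  have : IsIso ((K.op.πTruncGE (ComplexShape.embeddingUpIntLE n).op).f i) := by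
    rw [show (K.op.πTruncGE (ComplexShape.embeddingUpIntLE n).op).f i = _ from
      ComplexShape.Embedding.liftExtend_f (ComplexShape.embeddingUpIntLE n).op _
        (K.op.restrictionToTruncGE'_hasLift _) (i := j) hj']
    exact IsIso.comp_isIso' inferInstance (IsIso.comp_isIso' this (Iso.isIso_inv _))
  exact inferInstanceAs (IsIso ((K.op.πTruncGE (ComplexShape.embeddingUpIntLE n).op).f i).unop)

instance (K : CochainComplex 𝒜 ℤ) (n i : ℤ) : Mono ((K.ιTruncLE n).f i) :=
  inferInstanceAs (Mono ((HomologicalComplex.ιTruncLE K (ComplexShape.embeddingUpIntLE n)).f i))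

lemma exists_comp_ιTruncLE_f (K : CochainComplex 𝒜 ℤ) (n : ℤ) {T : 𝒜} (y : T ⟶ K.X n)
    (hy : y ≫ K.d n (n + 1) = 0) : ∃ t, t ≫ (K.ιTruncLE n).f n = y := by
  let S : CochainComplex 𝒜 ℤ := (HomologicalComplex.single 𝒜 (ComplexShape.up ℤ) n).obj T
  let φ : S ⟶ K :=
    HomologicalComplex.mkHomFromSingle y (by rintro k rfl; exact hy)
  refine ⟨(HomologicalComplex.singleObjXSelf _ n T).inv ≫
    (inv (S.ιTruncLE n) ≫ truncLEMap φ n).f n, ?_⟩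
  have h : (inv (S.ιTruncLE n) ≫ truncLEMap φ n) ≫ K.ιTruncLE n = φ := by
    rw [Category.assoc, ιTruncLE_naturality, IsIso.inv_hom_id_assoc]
  have hφ : φ.f n = (HomologicalComplex.singleObjXSelf _ n T).hom ≫ y :=
    HomologicalComplex.mkHomFromSingle_f _ _
  rw [Category.assoc, ← HomologicalComplex.comp_f, h, hφ, Iso.inv_hom_id_assoc]

section Truncations

variable {𝒞 : ObjectProperty 𝒜} {K : CochainComplex 𝒜 ℤ} {n : ℤ}

lemma isHomExact_mappingCone_πTruncGE [K.IsStrictlyGE n] [Mono (K.d n (n + 1))]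
    (h : IsHomEpi 𝒞 (K.pOpcycles (n + 1))) : IsHomExact 𝒞 (mappingCone (K.πTruncGE (n + 1))) := by
  refine isHomExact_mappingCone_of_isHomEpi (fun i => ?_) fun C _ j k hjk x hx hx' => ?_
  · obtain hi | rfl | hi := lt_trichotomy i (n + 1)
    · exact fun _ _ _ =>
        ⟨0, ((K.truncGE (n + 1)).isZero_of_isStrictlyGE (n + 1) i hi).eq_of_tgt _ _⟩
    · rw [πTruncGE_f_self]
      exact h.comp (.of_isIso _)
    · have := isIso_πTruncGE_f K (n + 1) i hi
      exact .of_isIso _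
  · obtain hk | rfl | rfl | hk : k < n ∨ k = n ∨ k = n + 1 ∨ n + 1 < k := by lia
    · exact ⟨0, (K.isZero_of_isStrictlyGE n k hk).eq_of_tgt _ _, by simp⟩
    · exact ⟨0, by simpa [← cancel_mono (K.d k (k + 1))] using hx.symm, by simp⟩
    · obtain rfl : j = n := by lia
      rw [πTruncGE_f_self, ← Category.assoc, Preadditive.IsIso.comp_right_eq_zero] at hx'
      obtain ⟨t, ht⟩ := KernelFork.IsLimit.lift' (Abelian.monoIsKernelOfCokernel _
        (K.opcyclesIsCokernel j (j + 1) (by simp))) x hx'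
      exact ⟨t, ht, ((K.truncGE (j + 1)).isZero_of_isStrictlyGE (j + 1) j (by lia)).eq_of_tgt _ _⟩
    · have := isIso_πTruncGE_f K (n + 1) k hk
      obtain rfl : x = 0 := by
        rwa [← Preadditive.IsIso.comp_right_eq_zero x ((K.πTruncGE (n + 1)).f k)]
      exact ⟨0, by simp, by simp⟩

lemma isHomExact_mappingCone_ιTruncLE [K.IsStrictlyLE (n + 1)]
    (h : IsHomEpi 𝒞 (K.d n (n + 1))) : IsHomExact 𝒞 (mappingCone (K.ιTruncLE n)) := by
  refine isHomExact_mappingCone_of_mono fun C hC i j k hij hjk x y hxy => ?_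
  obtain hj | rfl | rfl | hj : j < n ∨ j = n ∨ j = n + 1 ∨ n + 1 < j := by lia
  · have := isIso_ιTruncLE_f K n j hj
    exact ⟨y ≫ inv ((K.ιTruncLE n).f j), 0, by simp⟩
  · obtain rfl : x = 0 := ((K.truncLE j).isZero_of_isStrictlyLE j k (by lia)).eq_of_tgt _ _
    subst hjk
    obtain ⟨t, ht⟩ := exists_comp_ιTruncLE_f K j y (by simpa using hxy)
    exact ⟨t, 0, by simp [ht]⟩
  · obtain rfl : i = n := by lia
    obtain ⟨z, hz⟩ := h hC y
    exact ⟨0, z, by simp [hz]⟩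
  · exact ⟨0, 0, (K.isZero_of_isStrictlyLE (n + 1) j hj).eq_of_tgt _ _⟩

end Truncations

section StupidTruncation

variable (K : CochainComplex 𝒜 ℤ) (n : ℤ)

/-- The projection of a cochain complex onto its stupid truncation in degrees `≤ n`. -/
def πStupidTruncLE : K ⟶ K.stupidTrunc (ComplexShape.embeddingUpIntLE n) :=
  (ComplexShape.embeddingUpIntLE n).liftExtend (𝟙 _) fun j hj =>
    absurd hj (ComplexShape.Embedding.not_boundaryGE_next _ (j := j + 1) rfl)

lemma isIso_πStupidTruncLE_f (i : ℤ) (hi : i ≤ n) : IsIso ((πStupidTruncLE K n).f i) := by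
  have hj : (ComplexShape.embeddingUpIntLE n).f (n - i).toNat = i := by
    change n - ((n - i).toNat : ℤ) = i
    lia
  exact (ComplexShape.Embedding.isIso_liftExtend_f_iff _ _ _ hj).2
    (inferInstanceAs (IsIso (𝟙 (K.X ((ComplexShape.embeddingUpIntLE n).f (n - i).toNat)))))

instance : IsIso ((πStupidTruncLE K n).f n) := isIso_πStupidTruncLE_f K n n le_rfl

/-- The morphism from the stupid truncation of `K` in degrees `≤ n` to the object `K.X (n + 1)`,
placed in degree `n`, which is given by the differential. -/
def stupidTruncLEToSingle : K.stupidTrunc (ComplexShape.embeddingUpIntLE n) ⟶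
    (HomologicalComplex.single 𝒜 (ComplexShape.up ℤ) n).obj (K.X (n + 1)) :=
  HomologicalComplex.mkHomToSingle (inv ((πStupidTruncLE K n).f n) ≫ K.d n (n + 1)) (by
    rintro i (hi : i + 1 = n)
    have := isIso_πStupidTruncLE_f K n i (by lia)
    simp [← cancel_epi ((πStupidTruncLE K n).f i)])

lemma πStupidTruncLE_comp_stupidTruncLEToSingle_f :
    (πStupidTruncLE K n).f n ≫ (stupidTruncLEToSingle K n).f n =
      K.d n (n + 1) ≫ (HomologicalComplex.singleObjXSelf _ n _).inv := by
  simp [stupidTruncLEToSingle]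

variable {K} {𝒞 : ObjectProperty 𝒜}

lemma IsHomExact.mappingCone_stupidTruncLEToSingle (hK : IsHomExact 𝒞 K) [K.IsStrictlyLE (n + 1)] :
    IsHomExact 𝒞 (mappingCone (stupidTruncLEToSingle K n)) := by
  rw [isHomExact_iff] at hK
  have hS (i : ℤ) (hi : i ≠ n) : IsZero
      (((HomologicalComplex.single 𝒜 (ComplexShape.up ℤ) n).obj (K.X (n + 1))).X i) :=
    HomologicalComplex.isZero_single_obj_X _ _ _ _ hi
  refine isHomExact_mappingCone_of_isHomEpi (fun i C hC y => ?_) fun C hC j k hjk x hx hx' => ?_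
  · obtain rfl | hi := eq_or_ne i n
    · obtain ⟨t, ht⟩ := hK hC i (i + 1) _ rfl rfl
        (y ≫ (HomologicalComplex.singleObjXSelf _ i _).hom)
        ((K.isZero_of_isStrictlyLE (i + 1) _ (by lia)).eq_of_tgt _ _)
      exact ⟨t ≫ (πStupidTruncLE K i).f i, by
        simp [πStupidTruncLE_comp_stupidTruncLEToSingle_f, reassoc_of% ht]⟩
    · exact ⟨0, (hS i hi).eq_of_tgt _ _⟩
  · obtain hk | hk := lt_or_ge n k
    · exact ⟨0, (isZero_of_isStrictlyLE (K.stupidTrunc _) n k hk).eq_of_tgt _ _, by simp⟩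
    have := isIso_πStupidTruncLE_f K n k hk
    obtain ⟨x, rfl⟩ : ∃ x', x' ≫ (πStupidTruncLE K n).f k = x :=
      ⟨x ≫ inv ((πStupidTruncLE K n).f k), by simp⟩
    have hx₀ : x ≫ K.d k (k + 1) = 0 := by
      obtain rfl | hk := hk.eq_or_lt
      · rwa [Category.assoc, πStupidTruncLE_comp_stupidTruncLEToSingle_f, ← Category.assoc,
          Preadditive.IsIso.comp_right_eq_zero] at hx'
      · have := isIso_πStupidTruncLE_f K n (k + 1) hk
        rw [← Preadditive.IsIso.comp_right_eq_zero _ ((πStupidTruncLE K n).f (k + 1))]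
        simpa using hx
    obtain ⟨z, rfl⟩ := hK hC j k (k + 1) hjk rfl x hx₀
    exact ⟨z ≫ (πStupidTruncLE K n).f j, by simp, (hS j (by lia)).eq_of_tgt _ _⟩

end StupidTruncation

/-- A complete `𝒞`-resolution: an acyclic complex with terms in `𝒞` which is both
`Hom(𝒞, -)`-exact and `Hom(-, 𝒞)`-exact. -/
structure IsCompleteResolution (𝒞 : ObjectProperty 𝒜) (X : CochainComplex 𝒜 ℤ) : Prop where
  prop_X (i : ℤ) : 𝒞 (X.X i)
  acyclic : X.Acyclic
  isHomExact : IsHomExact 𝒞 X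
  isCohomExact : IsCohomExact 𝒞 X

lemma epi_toCycles_of_acyclic {X : CochainComplex 𝒜 ℤ} (hX : X.Acyclic) (i j : ℤ)
    (hij : i + 1 = j) : Epi (X.toCycles i j) :=
  Preadditive.epi_of_isZero_cokernel' _ (X.homologyIsCokernel i j (by simp [← hij]))
    (hX j).isZero_homology

lemma gorenstein_iff (𝒞 : ObjectProperty 𝒜) (M : 𝒜) :
    gorenstein 𝒞 M ↔
      ∃ X : CochainComplex 𝒜 ℤ, IsCompleteResolution 𝒞 X ∧ Nonempty (M ≅ X.cycles 0) := by
  have e (X : CochainComplex 𝒜 ℤ) (hX : X.Acyclic) : X.cycles 0 ≅ image (X.d (-1) 0) :=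
    have := epi_toCycles_of_acyclic hX (-1) 0 rfl
    have := strongEpi_of_epi (X.toCycles (-1) 0)
    image.isoStrongEpiMono _ _ (X.toCycles_i (-1) 0)
  constructor
  · rintro ⟨X, h₁, h₂, h₃, h₄, ⟨f⟩⟩
    exact ⟨X, ⟨h₁, h₂, h₃, h₄⟩, ⟨f ≪≫ (e X h₂).symm⟩⟩
  · rintro ⟨X, ⟨h₁, h₂, h₃, h₄⟩, ⟨f⟩⟩
    exact ⟨X, h₁, h₂, h₃, h₄, ⟨f ≪≫ e X h₂⟩⟩

instance (𝒞 : ObjectProperty 𝒜) : (gorenstein 𝒞).IsClosedUnderIsomorphisms where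
  of_iso e h := by
    obtain ⟨X, hX, ⟨e'⟩⟩ := (gorenstein_iff 𝒞 _).1 h
    exact (gorenstein_iff 𝒞 _).2 ⟨X, hX, ⟨e.symm ≪≫ e'⟩⟩

lemma exists_int_section {T : ℤ → Type*} (R : ∀ i, T i → T (i + 1) → Prop)
    (up : ∀ i t, ∃ t', R i t t') (down : ∀ i t', ∃ t, R i t t') (t₀ : T 0) :
    ∃ s : ∀ i, T i, s 0 = t₀ ∧ ∀ i, R i (s i) (s (i + 1)) := by
  choose p hp using up
  choose q hq using down
  let s : ∀ i, T i := fun i => match i with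
    | Int.ofNat n => Nat.rec (motive := fun n => T (Int.ofNat n)) t₀
        (fun n t => p (Int.ofNat n) t) n
    | Int.negSucc n => Nat.rec (motive := fun n => T (Int.negSucc n)) (q (Int.negSucc 0) t₀)
        (fun n t => q (Int.negSucc (n + 1)) t) n
  refine ⟨s, rfl, fun i => ?_⟩
  match i with
  | Int.ofNat n => exact hp (Int.ofNat n) _
  | Int.negSucc 0 => exact hq (Int.negSucc 0) t₀
  | Int.negSucc (n + 1) => exact hq (Int.negSucc (n + 1)) _

namespace IsCompleteResolution

variable {𝒞 : ObjectProperty 𝒜} {X Y : CochainComplex 𝒜 ℤ}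

lemma exists_hom_f_zero_eq (hX : IsCompleteResolution 𝒞 X) (hY : IsCompleteResolution 𝒞 Y)
    (φ : X.X 0 ⟶ Y.X 0) (hφ : X.d (-1) 0 ≫ φ ≫ Y.d 0 1 = 0) :
    ∃ F : X ⟶ Y, F.f 0 = φ := by
  have hX' := (isCohomExact_iff 𝒞 X).1 hX.isCohomExact
  have hY' := (isHomExact_iff 𝒞 Y).1 hY.isHomExact
  -- A stage consists of two consecutive components; neighbouring stages have to share one.
  let T (i : ℤ) := { p : (X.X i ⟶ Y.X i) × (X.X (i + 1) ⟶ Y.X (i + 1)) //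
    p.1 ≫ Y.d i (i + 1) = X.d i (i + 1) ≫ p.2 }
  obtain ⟨φ₁, hφ₁⟩ := hX' (hY.prop_X 1) (-1) 0 1 rfl rfl (φ ≫ Y.d 0 1) hφ
  obtain ⟨s, hs₀, hs⟩ := exists_int_section (T := T) (fun i t t' => t.1.2 = t'.1.1)
    (fun i ⟨⟨a, b⟩, (hab : a ≫ _ = _ ≫ b)⟩ => by
      obtain ⟨c, hc⟩ := hX' (hY.prop_X _) i (i + 1) (i + 1 + 1) rfl rfl
        (b ≫ Y.d _ (i + 1 + 1)) (by
        rw [← reassoc_of% hab, HomologicalComplex.d_comp_d, comp_zero])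
      exact ⟨⟨⟨b, c⟩, hc.symm⟩, rfl⟩)
    (fun i ⟨⟨b, c⟩, (hbc : b ≫ _ = _ ≫ c)⟩ => by
      obtain ⟨a, ha⟩ := hY' (hX.prop_X i) i (i + 1) (i + 1 + 1) rfl rfl (X.d _ _ ≫ b) (by
        rw [Category.assoc, hbc, HomologicalComplex.d_comp_d_assoc, zero_comp])
      exact ⟨⟨⟨a, b⟩, ha⟩, rfl⟩)
    ⟨⟨φ, φ₁⟩, hφ₁.symm⟩
  refine ⟨{ f := fun i => (s i).1.1, comm' := ?_ }, congrArg (fun t => t.1.1) hs₀⟩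
  rintro i _ rfl
  rw [(s i).2, hs i]

lemma exists_cyclesMap_eq (hX : IsCompleteResolution 𝒞 X) (hY : IsCompleteResolution 𝒞 Y)
    (f : X.cycles 0 ⟶ Y.cycles 0) :
    ∃ F : X ⟶ Y, HomologicalComplex.cyclesMap F 0 = f := by
  have := epi_toCycles_of_acyclic hX.acyclic (-1) 0 rfl
  obtain ⟨φ, hφ⟩ := (isCohomExact_iff 𝒞 X).1 hX.isCohomExact (hY.prop_X 0) (-2) (-1) 0 rfl rfl
    (X.toCycles (-1) 0 ≫ f ≫ Y.iCycles 0) (by simp)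
  obtain ⟨F, rfl⟩ := hX.exists_hom_f_zero_eq hY φ (by simp [reassoc_of% hφ])
  refine ⟨F, ?_⟩
  rw [← cancel_mono (Y.iCycles 0), ← cancel_epi (X.toCycles (-1) 0),
    HomologicalComplex.cyclesMap_i, X.toCycles_i_assoc, hφ]

end IsCompleteResolution

section MappingCone

variable {𝒞 : ObjectProperty 𝒜} {X Y : CochainComplex 𝒜 ℤ}

lemma IsCohomExact.mappingCone (hX : IsCohomExact 𝒞 X) (hY : IsCohomExact 𝒞 Y) (F : X ⟶ Y) :
    IsCohomExact 𝒞 (mappingCone F) := by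
  rw [isCohomExact_iff] at hX hY ⊢
  intro C hC i j k hij hjk φ hφ
  obtain ⟨α, β, rfl⟩ := mappingCone.decomp_from F φ k hjk
  have hβ : Y.d i j ≫ β = 0 := by
    simpa using (mappingCone.inr F).f i ≫= hφ
  have hαβ : F.f j ≫ β - X.d j k ≫ α = 0 := by
    simpa [mappingCone.inl_v_d_assoc F j i k (by lia) (by lia), neg_add_eq_sub]
      using (mappingCone.inl F).v j i (by lia) ≫= hφ
  obtain ⟨ψ, rfl⟩ := hY hC i j k hij hjk β hβ
  obtain ⟨χ, hχ⟩ := hX hC j k (k + 1) hjk rfl (F.f k ≫ ψ - α) (by simpa using hαβ)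
  refine ⟨(mappingCone.fst F).1.v k (k + 1) rfl ≫ χ +
    (mappingCone.snd F).v k k (add_zero k) ≫ ψ, ?_⟩
  simp only [Preadditive.comp_add, mappingCone.d_fst_v_assoc F j k (k + 1) hjk rfl,
    mappingCone.d_snd_v_assoc F j k hjk, Preadditive.neg_comp, Category.assoc, hχ,
    Preadditive.comp_sub, Preadditive.add_comp]
  abel

/-- The components of a mapping cone, as biproducts. -/
@[simps]
def mappingConeXIso (F : X ⟶ Y) (i j : ℤ) (hij : i + 1 = j) :
    (mappingCone F).X i ≅ X.X j ⊞ Y.X i where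
  hom := biprod.lift ((mappingCone.fst F).1.v i j hij) ((mappingCone.snd F).v i i (add_zero i))
  inv := biprod.desc ((mappingCone.inl F).v j i (by lia)) ((mappingCone.inr F).f i)
  hom_inv_id := by simp [mappingCone.id_X F i j hij]

lemma IsCompleteResolution.mappingCone [𝒞.IsClosedUnderFiniteProducts]
    (hX : IsCompleteResolution 𝒞 X) (hY : IsCompleteResolution 𝒞 Y) (F : X ⟶ Y) :
    IsCompleteResolution 𝒞 (mappingCone F) where
  prop_X i :=
    have := ObjectProperty.IsClosedUnderBinaryProducts.closedUnderIsomorphisms 𝒞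
    𝒞.prop_of_iso ((biprod.isoProd _ _).symm ≪≫ (mappingConeXIso F i (i + 1) rfl).symm)
      (𝒞.prop_prod _ _ (hX.prop_X _) (hY.prop_X _))
  acyclic := by
    have hX := hX.acyclic
    have hY := hY.acyclic
    rw [← HomotopyCategory.quotient_obj_mem_subcategoryAcyclic_iff_acyclic] at hX hY ⊢
    exact (HomotopyCategory.subcategoryAcyclic 𝒜).ext_of_isTriangulatedClosed₃ _
      (HomotopyCategory.mappingCone_triangleh_distinguished F) hX hY
  isHomExact := (acyclicK 𝒞).ext_of_isTriangulatedClosed₃ _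
    (HomotopyCategory.mappingCone_triangleh_distinguished F) hX.isHomExact hY.isHomExact
  isCohomExact := hX.isCohomExact.mappingCone hY.isCohomExact F

end MappingCone

/-- The inflations with Gorenstein cokernel: monomorphisms whose cokernel is in `𝒢(𝒞)` and
whose cokernel projection is a `𝒞`-epimorphism. -/
def gorensteinInflations (𝒞 : ObjectProperty 𝒜) : MorphismProperty 𝒜 := fun _ _ u =>
  Mono u ∧ gorenstein 𝒞 (cokernel u) ∧ IsHomEpi 𝒞 (cokernel.π u)

instance (𝒞 : ObjectProperty 𝒜) : (gorensteinInflations 𝒞).RespectsIso :=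
  .of_respects_arrow_iso _ fun f g e ⟨h₁, h₂, h₃⟩ => by
    let e' : cokernel f.hom ≅ cokernel g.hom :=
      cokernel.mapIso _ _ (Arrow.leftFunc.mapIso e) (Arrow.rightFunc.mapIso e) e.hom.w.symm
    have he' : cokernel.π f.hom ≫ e'.hom = e.hom.right ≫ cokernel.π g.hom := cokernel.π_desc _ _ _
    exact ⟨((MorphismProperty.monomorphisms 𝒜).arrow_mk_iso_iff e).1 h₁,
      (gorenstein 𝒞).prop_of_iso e' h₂, .of_comp (he' ▸ h₃.comp (.of_isIso _))⟩

lemma gorensteinInflations_iff {𝒞 : ObjectProperty 𝒜} {K L : 𝒜} {u : K ⟶ L}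
    {c : CokernelCofork u} (hc : IsColimit c) :
    gorensteinInflations 𝒞 u ↔ Mono u ∧ gorenstein 𝒞 c.pt ∧ IsHomEpi 𝒞 c.π := by
  let e : cokernel u ≅ c.pt := (cokernelIsCokernel u).coconePointUniqueUpToIso hc
  have he : cokernel.π u ≫ e.hom = c.π :=
    IsColimit.comp_coconePointUniqueUpToIso_hom (cokernelIsCokernel u) hc .one
  have he' : IsHomEpi 𝒞 (cokernel.π u) ↔ IsHomEpi 𝒞 c.π :=
    ⟨fun h => he ▸ h.comp (.of_isIso _), fun h => e.eq_comp_inv.2 he ▸ h.comp (.of_isIso _)⟩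
  rw [gorensteinInflations, (gorenstein 𝒞).prop_iff_of_iso e, he']

section MappingCone

variable {𝒞 : ObjectProperty 𝒜} {X Y : CochainComplex 𝒜 ℤ}

section

variable (F : X ⟶ Y) (i j : ℤ) (hij : i + 1 = j)

/-- The kernel of `mappingConeCyclesπ F i j hij`. -/
def mappingConeCyclesι : X.cycles j ⟶ Y.cycles j ⊞ X.X j :=
  biprod.lift (-HomologicalComplex.cyclesMap F j) (X.iCycles j)

/-- The cycles of a mapping cone, presented by cycles of the target and arbitrary elements of the
source: `(y, x)` is sent to the sum of `y` and of the boundary of `x`. -/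
def mappingConeCyclesπ : Y.cycles j ⊞ X.X j ⟶ (mappingCone F).cycles j :=
  biprod.desc (HomologicalComplex.cyclesMap (mappingCone.inr F) j)
    ((mappingCone.inl F).v j i (by lia) ≫ (mappingCone F).toCycles i j)

lemma mappingConeCyclesπ_comp_iCycles :
    mappingConeCyclesπ F i j hij ≫ (mappingCone F).iCycles j =
      biprod.fst ≫ Y.iCycles j ≫ (mappingCone.inr F).f j +
        biprod.snd ≫ (F.f j ≫ (mappingCone.inr F).f j -
          X.d j (j + 1) ≫ (mappingCone.inl F).v (j + 1) j (by lia)) := by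
  ext <;> simp [mappingConeCyclesπ, mappingCone.inl_v_d F j i (j + 1) (by lia) (by lia)]

lemma mappingConeCyclesι_comp_π : mappingConeCyclesι F j ≫ mappingConeCyclesπ F i j hij = 0 := by
  simp [← cancel_mono ((mappingCone F).iCycles j), mappingConeCyclesπ_comp_iCycles,
    mappingConeCyclesι]

lemma mappingConeCycles_exact :
    (ShortComplex.mk _ _ (mappingConeCyclesι_comp_π F i j hij)).Exact := by
  rw [ShortComplex.exact_iff_exact_up_to_refinements]
  intro T (t : T ⟶ Y.cycles j ⊞ X.X j) (ht : t ≫ mappingConeCyclesπ F i j hij = 0)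
  have h := ht =≫ (mappingCone F).iCycles j
  rw [Category.assoc, mappingConeCyclesπ_comp_iCycles] at h
  have hx : (t ≫ biprod.snd) ≫ X.d j (j + 1) = 0 := by
    simpa using h =≫ (mappingCone.fst F).1.v j (j + 1) rfl
  have hxy : t ≫ biprod.fst ≫ Y.iCycles j + t ≫ biprod.snd ≫ F.f j = 0 := by
    simpa using h =≫ (mappingCone.snd F).v j j (add_zero j)
  refine ⟨T, 𝟙 T, inferInstance, X.liftCycles _ (j + 1) (by simp) hx, biprod.hom_ext _ _ ?_ ?_⟩
  · simpa [← cancel_mono (Y.iCycles j), mappingConeCyclesι] using eq_neg_of_add_eq_zero_left hxy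
  · simp [mappingConeCyclesι]

lemma toCycles_mappingCone_eq : (mappingCone F).toCycles i j =
    biprod.lift ((mappingCone.snd F).v i i (add_zero i) ≫ Y.toCycles i j)
      ((mappingCone.fst F).1.v i j hij) ≫ mappingConeCyclesπ F i j hij := by
  rw [← cancel_epi (mappingConeXIso F i j hij).inv]
  ext <;> simp [mappingConeCyclesπ, ← cancel_mono ((mappingCone F).iCycles j)]

end

lemma gorensteinInflations_mappingConeCyclesι [𝒞.IsClosedUnderFiniteProducts]
    (hX : IsCompleteResolution 𝒞 X) (hY : IsCompleteResolution 𝒞 Y) (F : X ⟶ Y) :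
    gorensteinInflations 𝒞 (mappingConeCyclesι F 0) := by
  have hW := hX.mappingCone hY F
  have hπ := toCycles_mappingCone_eq F (-1) 0 rfl
  have hι : Mono (mappingConeCyclesι F 0) := mono_of_mono_fac (biprod.lift_snd _ (X.iCycles 0))
  have : Epi (mappingConeCyclesπ F (-1) 0 rfl) :=
    have := epi_toCycles_of_acyclic hW.acyclic (-1) 0 rfl
    epi_of_epi_fac hπ.symm
  exact (gorensteinInflations_iff (mappingConeCycles_exact F (-1) 0 rfl).gIsCokernel).2
    ⟨hι, (gorenstein_iff 𝒞 _).2 ⟨_, hW, ⟨.refl _⟩⟩,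
      .of_comp (hπ ▸ hW.isHomExact.isHomEpi_toCycles (-1) 0 rfl)⟩

lemma gorenstein.exists_gorensteinInflations [𝒞.IsClosedUnderFiniteProducts] {G : 𝒜}
    (hG : gorenstein 𝒞 G) : ∃ (C : 𝒜) (j : G ⟶ C), 𝒞 C ∧
      ∀ ⦃G' : 𝒜⦄, gorenstein 𝒞 G' → ∀ f : G ⟶ G', gorensteinInflations 𝒞 (biprod.lift f j) := by
  obtain ⟨X, hX, ⟨e⟩⟩ := (gorenstein_iff 𝒞 G).1 hG
  refine ⟨X.X 0, e.hom ≫ X.iCycles 0, hX.prop_X 0, fun G' hG' f => ?_⟩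
  obtain ⟨Y, hY, ⟨e'⟩⟩ := (gorenstein_iff 𝒞 G').1 hG'
  obtain ⟨F, hF⟩ := hX.exists_cyclesMap_eq hY (-(e.inv ≫ f ≫ e'.hom))
  refine ((gorensteinInflations 𝒞).arrow_mk_iso_iff
    (Arrow.isoMk' _ _ e (biprod.mapIso e' (.refl _)) (biprod.hom_ext _ _ ?_ ?_))).2
      (gorensteinInflations_mappingConeCyclesι hX hY F) <;>
    simp [mappingConeCyclesι, hF]

end MappingCone

instance (𝒞 : ObjectProperty 𝒜) [𝒞.IsClosedUnderFiniteProducts] : 𝒞.ContainsZero where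
  exists_zero := ⟨_, isZero_zero 𝒜, 𝒞.prop_of_isTerminal _ (isZero_zero 𝒜).isTerminal⟩

open scoped ZeroObject in
instance (𝒞 : ObjectProperty 𝒜) [𝒞.IsClosedUnderFiniteProducts] :
    (gorenstein 𝒞).ContainsZero where
  exists_zero := by
    have := ObjectProperty.IsClosedUnderBinaryProducts.closedUnderIsomorphisms 𝒞
    have hX (i : ℤ) : IsZero ((0 : CochainComplex 𝒜 ℤ).X i) :=
      (HomologicalComplex.eval 𝒜 (ComplexShape.up ℤ) i).map_isZero (isZero_zero _)
    refine ⟨_, (hX 0).of_mono (HomologicalComplex.iCycles _ 0), (gorenstein_iff 𝒞 _).2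
      ⟨0, ⟨fun i => 𝒞.prop_of_isZero (hX i), fun i => ShortComplex.exact_of_isZero_X₂ _ (hX i),
        (isHomExact_iff 𝒞 _).2 ?_, (isCohomExact_iff 𝒞 _).2 ?_⟩, ⟨.refl _⟩⟩⟩
    · exact fun C _ i j k _ _ φ _ => ⟨0, (hX j).eq_of_tgt _ _⟩
    · exact fun C _ i j k _ _ φ _ => ⟨0, (hX j).eq_of_src _ _⟩

lemma prop_single_X (P : ObjectProperty 𝒜) [P.ContainsZero] [P.IsClosedUnderIsomorphisms] {M : 𝒜}
    (hM : P M) (n i : ℤ) :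
    P (((HomologicalComplex.single 𝒜 (ComplexShape.up ℤ) n).obj M).X i) := by
  obtain rfl | h := eq_or_ne i n
  · exact P.prop_of_iso (HomologicalComplex.singleObjXSelf _ i M).symm hM
  · exact P.prop_of_isZero (HomologicalComplex.isZero_single_obj_X _ _ _ _ h)

section Approximations

variable {𝒞 : ObjectProperty 𝒜}

lemma gorenstein.exists_isRightApprox {G : 𝒜} (hG : gorenstein 𝒞 G) :
    ∃ (C : 𝒜) (f : C ⟶ G), IsRightApprox 𝒞 f := by
  obtain ⟨X, hX, ⟨e⟩⟩ := (gorenstein_iff 𝒞 G).1 hG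
  exact ⟨_, X.toCycles (-1) 0 ≫ e.inv, hX.prop_X _,
    (hX.isHomExact.isHomEpi_toCycles (-1) 0 rfl).comp (.of_isIso _)⟩

lemma HasProperResolution.exists_isHomEpi {𝒟 : ObjectProperty 𝒜} {M : 𝒜} {n : ℕ}
    (h : HasProperResolution 𝒞 𝒟 M n) : ∃ (D : 𝒜) (f : D ⟶ M), 𝒟 D ∧ IsHomEpi 𝒞 f := by
  obtain ⟨E, -, hE, ⟨e⟩, hE', hE''⟩ := h
  refine ⟨E.X 0, E.d 0 1 ≫ e.hom, hE 0 (by lia) le_rfl, .comp (fun C hC y => ?_) (.of_isIso _)⟩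
  exact (isHomExact_iff 𝒞 E).1 hE'' hC 0 1 2 rfl rfl y ((hE' 2 (by lia)).eq_of_tgt _ _)

lemma isContravariantlyFinite_of_hasProperResolution
    (h : ∀ M : 𝒜, ∃ n, HasProperResolution 𝒞 (gorenstein 𝒞) M n) :
    IsContravariantlyFinite 𝒞 := by
  intro M
  obtain ⟨n, hn⟩ := h M
  obtain ⟨G, p, hG, hp⟩ := hn.exists_isHomEpi
  obtain ⟨C, q, hC, hq⟩ := hG.exists_isRightApprox
  exact ⟨C, q ≫ p, hC, IsHomEpi.comp hq hp⟩

end Approximations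

section Concentration

variable {𝒞 : ObjectProperty 𝒜}

lemma IsHomEpi.mappingCone_d {K L : CochainComplex 𝒜 ℤ} {f : K ⟶ L} {i j : ℤ} (hij : i + 1 = j)
    [K.IsStrictlyLE j] (h : IsHomEpi 𝒞 (f.f j)) : IsHomEpi 𝒞 ((mappingCone f).d i j) := by
  intro C hC y
  have hK : IsZero (K.X (j + 1)) := K.isZero_of_isStrictlyLE j (j + 1) (by lia)
  obtain ⟨x, z, rfl⟩ := mappingCone.decomp_to f y (j + 1) rfl
  obtain rfl : x = 0 := hK.eq_of_tgt _ _
  obtain ⟨t, rfl⟩ := h hC z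
  have hd : K.d j (j + 1) = 0 := hK.eq_of_tgt _ _
  exact ⟨t ≫ (mappingCone.inl f).v j i (by lia), by
    simp [mappingCone.inl_v_d f j i (j + 1) (by lia) (by lia), hd]⟩

variable [𝒞.IsClosedUnderFiniteProducts]

lemma exists_sgIso_isStrictlyLE (h𝒞 : IsContravariantlyFinite 𝒞) (X : CochainComplex 𝒜 ℤ)
    (a b : ℤ) (hab : a ≤ b) [X.IsStrictlyGE a] [X.IsStrictlyLE (b + 1)] :
    ∃ Y : CochainComplex 𝒜 ℤ, Y.IsStrictlyGE a ∧ Y.IsStrictlyLE b ∧ SgIso 𝒞 X Y := by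
  have := ObjectProperty.IsClosedUnderBinaryProducts.closedUnderIsomorphisms 𝒞
  obtain ⟨C, ε, hC, hε⟩ := h𝒞 (X.X (b + 1))
  let f : (HomologicalComplex.single 𝒜 (ComplexShape.up ℤ) (b + 1)).obj C ⟶ X :=
    HomologicalComplex.mkHomFromSingle ε (fun k (hk : b + 1 + 1 = k) =>
      (X.isZero_of_isStrictlyLE (b + 1) k (by lia)).eq_of_tgt _ _)
  have hf : f.f (b + 1) = (HomologicalComplex.singleObjXSelf _ (b + 1) C).hom ≫ ε :=
    HomologicalComplex.mkHomFromSingle_f _ _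
  let W := mappingCone f
  have : W.IsStrictlyGE a := isStrictlyGE_mappingCone f (b + 1) a a (by lia) (by lia)
  have : W.IsStrictlyLE (b + 1) := isStrictlyLE_mappingCone f (b + 1) (b + 1) _ le_rfl le_rfl
  refine ⟨W.truncLE b, inferInstance, inferInstance,
    (SgIso.mappingCone_of_source_terms (.mk _ (b + 1) (b + 1)) (.mk X a (b + 1)) f
      (prop_single_X 𝒞 hC _)).trans
    (SgIso.of_isHomExact_mappingCone (.mk _ a b) (.mk W a (b + 1)) (W.ιTruncLE b)
      (isHomExact_mappingCone_ιTruncLE (.mappingCone_d rfl ?_))).symm⟩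
  rw [hf]
  exact (IsHomEpi.of_isIso _).comp hε

lemma exists_sgIso_concentrated (h𝒞 : IsContravariantlyFinite 𝒞) (X : CochainComplex 𝒜 ℤ)
    (a : ℤ) (n : ℕ) [X.IsStrictlyGE a] [X.IsStrictlyLE (a + n)] :
    ∃ Y : CochainComplex 𝒜 ℤ, Y.IsStrictlyGE a ∧ Y.IsStrictlyLE a ∧ SgIso 𝒞 X Y := by
  induction n generalizing X with
  | zero =>
    have : X.IsStrictlyLE a := X.isStrictlyLE_of_le (a + (0 : ℕ)) a (by simp)
    exact ⟨X, inferInstance, inferInstance, .of_iso (.mk X a a) (Iso.refl X)⟩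
  | succ n ih =>
    have : X.IsStrictlyLE (a + n + 1) := X.isStrictlyLE_of_le (a + (n + 1 : ℕ)) _ (by lia)
    obtain ⟨Y, _, _, hY⟩ := exists_sgIso_isStrictlyLE h𝒞 X a (a + n) (by lia)
    obtain ⟨Z, h₁, h₂, hZ⟩ := ih Y
    exact ⟨Z, h₁, h₂, hY.trans hZ⟩

end Concentration

section GorensteinTerms

variable {𝒞 : ObjectProperty 𝒜}

lemma mappingCone_d_mem_iff (P : MorphismProperty 𝒜) [P.RespectsIso] {K L : CochainComplex 𝒜 ℤ}
    (f : K ⟶ L) (i j k : ℤ) (hij : i + 1 = j) (hjk : j + 1 = k) (hL : IsZero (L.X i)) :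
    P ((mappingCone f).d i j) ↔ P (biprod.lift (-K.d j k) (f.f j)) := by
  have hji : j + -1 = i := by lia
  have h : (mappingCone.inl f).v j i hji ≫ (mappingCone f).d i j =
      biprod.lift (-K.d j k) (f.f j) ≫ (mappingConeXIso f j k hjk).inv := by
    simp [mappingCone.inl_v_d f j i k (by lia) (by lia), neg_add_eq_sub]
  have : IsIso ((mappingCone.inl f).v j i hji) := by
    refine ⟨(mappingCone.fst f).1.v i j hij, by simp, ?_⟩
    simp [← mappingCone.id_X f i j hij, hL.eq_of_src ((mappingCone.inr f).f i) 0]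
  rw [← P.cancel_left_of_respectsIso ((mappingCone.inl f).v j i hji), h,
    P.cancel_right_of_respectsIso]

lemma gorensteinInflations_d_iff (K : CochainComplex 𝒜 ℤ) (i j : ℤ) (hij : i + 1 = j) :
    gorensteinInflations 𝒞 (K.d i j) ↔
      Mono (K.d i j) ∧ gorenstein 𝒞 (K.opcycles j) ∧ IsHomEpi 𝒞 (K.pOpcycles j) :=
  gorensteinInflations_iff (K.opcyclesIsCokernel i j (by simp [← hij]))

lemma gorenstein_truncGE_X [𝒞.IsClosedUnderFiniteProducts] {K : CochainComplex 𝒜 ℤ} {n : ℤ}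
    (h : gorenstein 𝒞 (K.opcycles n)) (hK : ∀ i, n < i → gorenstein 𝒞 (K.X i)) (i : ℤ) :
    gorenstein 𝒞 ((K.truncGE n).X i) := by
  obtain hi | rfl | hi := lt_trichotomy i n
  · exact (gorenstein 𝒞).prop_of_isZero ((K.truncGE n).isZero_of_isStrictlyGE n i hi)
  · exact (gorenstein 𝒞).prop_of_iso (K.truncGEXIsoOpcycles i).symm h
  · exact (gorenstein 𝒞).prop_of_iso (K.truncGEXIso n i hi).symm (hK i hi)

variable [𝒞.IsClosedUnderFiniteProducts] {X : CochainComplex 𝒜 ℤ}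

lemma exists_gorensteinInflations_mappingCone_d (hX : ∀ i, gorenstein 𝒞 (X.X i)) (i j : ℤ)
    (hij : i + 1 = j) [X.IsStrictlyGE j] :
    ∃ (C : 𝒜) (f : X ⟶ (HomologicalComplex.single 𝒜 (ComplexShape.up ℤ) j).obj C),
      𝒞 C ∧ gorensteinInflations 𝒞 ((mappingCone f).d i j) := by
  obtain ⟨C, g, hC, hg⟩ := (hX j).exists_gorensteinInflations
  let e := HomologicalComplex.singleObjXSelf (ComplexShape.up ℤ) j C
  let f : X ⟶ (HomologicalComplex.single 𝒜 (ComplexShape.up ℤ) j).obj C :=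
    HomologicalComplex.mkHomToSingle g (fun k (hk : k + 1 = j) =>
      (X.isZero_of_isStrictlyGE j k (by lia)).eq_of_src _ _)
  have hf : f.f j = g ≫ e.inv := HomologicalComplex.mkHomToSingle_f _ _
  have hlift : biprod.lift (-X.d j (j + 1)) (f.f j) =
      biprod.lift (-X.d j (j + 1)) g ≫ (biprod.mapIso (.refl _) e.symm).hom := by
    ext <;> simp [hf, -Preadditive.neg_comp]
  refine ⟨C, f, hC, (mappingCone_d_mem_iff _ f i j _ hij rfl
    (HomologicalComplex.isZero_single_obj_X _ _ _ _ (by lia))).2 ?_⟩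
  rw [hlift, MorphismProperty.cancel_right_of_respectsIso (gorensteinInflations 𝒞)]
  exact hg (hX (j + 1)) _

lemma exists_sgIso_shift_one (hX : ∀ i, gorenstein 𝒞 (X.X i))
    (a b : ℤ) (hab : a < b) [X.IsStrictlyGE (a + 1)] [X.IsStrictlyLE (b + 1)] :
    ∃ Y : CochainComplex 𝒜 ℤ, Y.IsStrictlyGE (a + 1) ∧ Y.IsStrictlyLE b ∧
      (∀ i, gorenstein 𝒞 (Y.X i)) ∧ SgIso 𝒞 Y (X⟦(1 : ℤ)⟧) := by
  have := ObjectProperty.IsClosedUnderBinaryProducts.closedUnderIsomorphisms 𝒞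
  obtain ⟨C, f, hC, hf⟩ := exists_gorensteinInflations_mappingCone_d hX a (a + 1) rfl
  obtain ⟨_, hf, hf'⟩ := (gorensteinInflations_d_iff _ _ _ rfl).1 hf
  have hS (i : ℤ) (hi : i ≠ a + 1) :=
    HomologicalComplex.isZero_single_obj_X (ComplexShape.up ℤ) (a + 1) C i hi
  let W := mappingCone f
  have : W.IsStrictlyGE a := isStrictlyGE_mappingCone f (a + 1) (a + 1) a (by lia) (by lia)
  have : W.IsStrictlyLE b := by
    rw [isStrictlyLE_iff]
    intro i hi
    rw [mappingCone.isZero_X_iff]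
    exact ⟨X.isZero_of_isStrictlyLE (b + 1) _ (by lia), hS i (by lia)⟩
  have hW (i : ℤ) (hi : a + 1 < i) : gorenstein 𝒞 (W.X i) :=
    (gorenstein 𝒞).prop_of_iso (isoBiprodZero (hS i (by lia)) ≪≫
      (mappingConeXIso f i (i + 1) rfl).symm) (hX (i + 1))
  exact ⟨W.truncGE (a + 1), inferInstance, inferInstance, gorenstein_truncGE_X hf hW,
    (SgIso.of_isHomExact_mappingCone (.mk W a b) (.mk _ (a + 1) b) (W.πTruncGE (a + 1))
      (isHomExact_mappingCone_πTruncGE hf')).symm.trans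
    (SgIso.mappingCone_of_target_terms (.mk X (a + 1) (b + 1)) (.mk _ (a + 1) (a + 1)) f
      (prop_single_X 𝒞 hC _))⟩

lemma exists_gorenstein_sgIso_single (n : ℕ) (hX : ∀ i, gorenstein 𝒞 (X.X i))
    [X.IsStrictlyGE (-n)] [X.IsStrictlyLE 0] :
    ∃ G, gorenstein 𝒞 G ∧ SgIso 𝒞 X ((singleFunctor 𝒜 0).obj G) := by
  induction n generalizing X with
  | zero =>
    have : X.IsStrictlyGE 0 := X.isStrictlyGE_of_ge 0 (-(0 : ℕ)) (by simp)
    obtain ⟨G, ⟨e⟩⟩ := X.exists_iso_single 0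
    let e₀ : X.X 0 ≅ ((HomologicalComplex.single 𝒜 (ComplexShape.up ℤ) 0).obj G).X 0 :=
      (HomologicalComplex.eval 𝒜 (ComplexShape.up ℤ) 0).mapIso e
    exact ⟨G, (gorenstein 𝒞).prop_of_iso (e₀ ≪≫ HomologicalComplex.singleObjXSelf _ 0 G) (hX 0),
      .of_iso (.mk X 0 0) e⟩
  | succ n ih =>
    let X' := X⟦(-1 : ℤ)⟧
    have : X'.IsStrictlyGE (-n - 1 + 1) := X.isStrictlyGE_shift (-(n + 1 : ℕ)) (-1) _ (by lia)
    have : X'.IsStrictlyLE (0 + 1) := X.isStrictlyLE_shift 0 (-1) _ (by lia)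
    obtain ⟨Y, _, _, hY, h⟩ := exists_sgIso_shift_one (X := X') (fun i => hX (i + -1))
      (-n - 1) 0 (by lia)
    have : Y.IsStrictlyGE (-n) := Y.isStrictlyGE_of_ge _ (-n - 1 + 1) (by lia)
    obtain ⟨G, hG, h'⟩ := ih hY
    exact ⟨G, hG, (SgIso.of_iso (.mk X (-(n + 1 : ℕ)) 0)
      (shiftNegShift X (1 : ℤ)).symm).trans (h.symm.trans h')⟩

end GorensteinTerms

section ProperResolution

variable {𝒞 𝒟 : ObjectProperty 𝒜}

lemma stupidTruncLE_X_mem [𝒟.ContainsZero] [𝒟.IsClosedUnderIsomorphisms] {K : CochainComplex 𝒜 ℤ}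
    {n : ℤ} (hK : ∀ i ≤ n, 𝒟 (K.X i)) (i : ℤ) :
    𝒟 ((K.stupidTrunc (ComplexShape.embeddingUpIntLE n)).X i) := by
  obtain hi | hi := lt_or_ge n i
  · exact 𝒟.prop_of_isZero (isZero_of_isStrictlyLE (K.stupidTrunc _) n i hi)
  · have := isIso_πStupidTruncLE_f K n i hi
    exact 𝒟.prop_of_iso (asIso ((πStupidTruncLE K n).f i)) (hK i hi)

lemma HasProperResolution.exists_sgIso_single [𝒟.ContainsZero] [𝒟.IsClosedUnderIsomorphisms]
    {M : 𝒜} {n : ℕ} (h : HasProperResolution 𝒞 𝒟 M n) (a : ℤ) :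
    ∃ R : CochainComplex 𝒜 ℤ, R.IsStrictlyGE (a - n) ∧ R.IsStrictlyLE a ∧ (∀ i, 𝒟 (R.X i)) ∧
      SgIso 𝒞 R ((singleFunctor 𝒜 a).obj M) := by
  obtain ⟨E, hE₁, hE₂, ⟨e⟩, hE₃, hE⟩ := h
  let F : CochainComplex 𝒜 ℤ := E⟦-a⟧
  let eF : F.X (a + 1) ≅ M := E.XIsoOfEq (by lia) ≪≫ e
  have : F.IsStrictlyGE (a - n) := (F.isStrictlyGE_iff _).2 fun i hi => hE₁ (i + -a) (by lia)
  have : F.IsStrictlyLE (a + 1) := (F.isStrictlyLE_iff _).2 fun i hi => hE₃ (i + -a) (by lia)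
  let R : CochainComplex 𝒜 ℤ := F.stupidTrunc (ComplexShape.embeddingUpIntLE a)
  have hF (i : ℤ) (hi : i ≤ a) : 𝒟 (F.X i) := by
    obtain hi' | hi' := lt_or_ge i (a - n)
    · exact 𝒟.prop_of_isZero (hE₁ (i + -a) (by lia))
    · exact hE₂ (i + -a) (by lia) (by lia)
  exact ⟨R, inferInstance, inferInstance, stupidTruncLE_X_mem hF,
    (SgIso.of_isHomExact_mappingCone (.mk R (a - n) a) (.mk _ a a) (stupidTruncLEToSingle F a)
      ((hE.shift (-a)).mappingCone_stupidTruncLEToSingle a)).trans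
    (.of_iso (.mk _ a a) ((singleFunctor 𝒜 a).mapIso eF))⟩

lemma exists_hasProperResolution {M : 𝒜} (h : properDim 𝒞 𝒟 M < ⊤) :
    ∃ n, HasProperResolution 𝒞 𝒟 M n := by
  by_contra! hM
  simp [properDim, hM] at h

end ProperResolution

lemma IsBoundedComplex.exists_gorenstein_sgIso {𝒞 : ObjectProperty 𝒜}
    [𝒞.IsClosedUnderFiniteProducts]
    (hdim : ∀ M : 𝒜, ∃ n, HasProperResolution 𝒞 (gorenstein 𝒞) M n)
    {X : CochainComplex 𝒜 ℤ} (hX : IsBoundedComplex X) :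
    ∃ G, gorenstein 𝒞 G ∧ SgIso 𝒞 X ((singleFunctor 𝒜 0).obj G) := by
  obtain ⟨a, b, _, _⟩ := hX
  obtain ⟨c, hc⟩ : ∃ c : ℕ, -(c : ℤ) ≤ a := ⟨(-a).toNat, by lia⟩
  have : X.IsStrictlyGE (-c) := X.isStrictlyGE_of_ge _ a hc
  have : X.IsStrictlyLE (-c + (b + c).toNat) := X.isStrictlyLE_of_le b _ (by lia)
  obtain ⟨Y, _, _, hXY⟩ := exists_sgIso_concentrated
    (isContravariantlyFinite_of_hasProperResolution hdim) X (-c) (b + c).toNat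
  obtain ⟨M, ⟨e⟩⟩ := Y.exists_iso_single (-c)
  obtain ⟨n, hn⟩ := hdim M
  obtain ⟨R, _, _, hR, hRM⟩ := hn.exists_sgIso_single (-c)
  have : R.IsStrictlyGE (-(c + n : ℕ)) := R.isStrictlyGE_of_ge _ (-c - n) (by lia)
  have : R.IsStrictlyLE 0 := R.isStrictlyLE_of_le (-c) _ (by lia)
  obtain ⟨G, hG, hRG⟩ := exists_gorenstein_sgIso_single (c + n) hR
  have hYM : SgIso 𝒞 Y ((singleFunctor 𝒜 (-c)).obj M) := .of_iso (.mk Y (-c) (-c)) e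
  exact ⟨G, hG, hXY.trans (hYM.trans (hRM.symm.trans hRG))⟩

end RelSing

end

theorem theorem4p11_general {𝒜 : Type u} [Category.{v} 𝒜] [Abelian 𝒜] (𝒞 : ObjectProperty 𝒜)
    [𝒞.IsClosedUnderFiniteProducts]
    (hdim : ∀ M : 𝒜, RelSing.properDim 𝒞 (RelSing.gorenstein 𝒞) M < ⊤) :
    (RelSing.theta 𝒞).EssSurj where
  mem_essImage Z := by
    let X : RelSing.Kb 𝒜 := (RelSing.Qb 𝒞).objPreimage ((RelSing.Qsg 𝒞).objPreimage Z)
    obtain ⟨G, hG, _, _, ⟨e⟩⟩ := RelSing.IsBoundedComplex.exists_gorenstein_sgIso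
      (fun M => RelSing.exists_hasProperResolution (hdim M)) (X := X.obj.as) X.property
    exact ⟨⟨G, hG⟩, ⟨e.symm ≪≫
      (RelSing.Qsg 𝒞).mapIso ((RelSing.Qb 𝒞).objObjPreimageIso _) ≪≫
      (RelSing.Qsg 𝒞).objObjPreimageIso Z⟩⟩

/-- Let `A` be a finite-dimensional algebra over a field, let `𝒜` be the category of finitely
generated left `A`-modules, and let `𝒞` be a full additive subcategory of `𝒜` which is admissible
(in particular contravariantly finite) and closed under direct summands. If the `𝒞`-proper
`𝒢(𝒞)`-dimension of `𝒜` is finite, then `θ : 𝒢(𝒞) ⥤ D_{𝒞-sg}(𝒜)` is essentially surjective. -/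
theorem theorem4p11 {k : Type v} [Field k] {A : Type u} [Ring A] [Algebra k A] [Module.Finite k A]
    (𝒞 : ObjectProperty (FGModuleCat.{u} A))
    [𝒞.IsClosedUnderFiniteProducts] [𝒞.IsStableUnderRetracts]
    (hadm : RelSing.IsAdmissible 𝒞) :
    haveI : IsNoetherianRing A := IsNoetherianRing.of_finite k A
    RelSing.properDimOf 𝒞 (RelSing.gorenstein 𝒞) ⊤ < ⊤ → (RelSing.theta 𝒞).EssSurj := by
  intro hdim
  have : IsNoetherianRing A := IsNoetherianRing.of_finite k A
  exact theorem4p11_general 𝒞 fun M => (le_iSup₂_of_le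
    (f := fun M (_ : (⊤ : ObjectProperty _) M) => RelSing.properDim 𝒞 (RelSing.gorenstein 𝒞) M)
    M trivial le_rfl).trans_lt hdim
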